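/- Conventions. A frame is a complete lattice in which finite meets distribute over arbitrary joins; frame maps preserve finite meets and all joins, and the category of locales is the opposite of the category of frames. Write $\Omega X$ for the frame of opens of a locale $X$ and $f^{-1}:\Omega Y\to\Omega X$ for the frame map of a locale map $f:X\to Y$. Let $L\otimes L$ be the coproduct frame, generated under joins by the rectangles $x\otimes y=\iota_1(x)\wedge\iota_2(y)$, so that $\Omega(X\times X)=\Omega X\otimes\Omega X$. A localic relation on $X$ is a sublocale $r:R\rightarrowtail X\times X$, with source and target maps $s=\mathrm{pr}_1 r$ and $t=\mathrm{pr}_2 r$. It has open cones if $s$ and $t$ are open, i.e. $s^{-1}$ and $t^{-1}$ have left adjoints $s_!$, $t_!$ with $s_!(O\wedge s^{-1}U)=s_!(O)\wedge U$ and $t_!(O\wedge t^{-1}U)=t_!(O)\wedge U$. Its cones are then $\uparrow_R=t_!s^{-1}$ and $\downarrow_R=s_!t^{-1}$. A locale map $f:X\to Y$ is monotone $(X,R)\to(Y,Q)$ if $(f\times f)\circ r$ factors through $Q\rightarrowtail Y\times Y$. Let $\mathsf{rocLoc}$ be the category of pairs $(X,R)$ of a locale and an open cone relation on it, with monotone maps.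 A conic frame $(L,\uparrow,\downarrow)$ is a frame $L$ with maps $\uparrow,\downarrow:L\to L$ that preserve all joins and are parallel: $\uparrow x\wedge y\le\,\uparrow(x\wedge\downarrow y)$ and $x\wedge\downarrow y\le\,\downarrow(\uparrow x\wedge y)$ for all $x,y\in L$. A conic morphism $h:(L,\uparrow,\downarrow)\to(M,\uparrow',\downarrow')$ is a frame map $h:L\to M$ with $\uparrow' h(x)\le h(\uparrow x)$ and $\downarrow' h(x)\le h(\downarrow x)$ for all $x\in L$. Let $\mathsf{ConicFrm}$ be the resulting category. For a conic frame $(\Omega X,\uparrow,\downarrow)$ let $\sim$ be the relation on rectangles of $\Omega X\otimes\Omega X$ given by $a\otimes b\sim c\otimes d$ iff $\uparrow a\wedge b=\,\uparrow c\wedge d$ and $a\wedge\downarrow b=c\wedge\downarrow d$. Let $R_{\uparrow\downarrow}\rightarrowtail X\times X$ be the sublocale whose sublocale set consists of the $\sim$-saturated elements, i.e. those $w\in\Omega X\otimes\Omega X$ such that whenever $p\sim q$ and $v\in\Omega X\otimes\Omega X$, one has $p\wedge v\le w$ iff $q\wedge v\le w$. Theorem. The functors $$\mathsf{Cone}:\mathsf{rocLoc}\to\mathsf{ConicFrm}^{\mathrm{op}},\quad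 (X,R)\mapsto(\Omega X,\uparrow_R,\downarrow_R),\quad f\mapsto f^{-1},$$ $$\mathsf{Rel}:\mathsf{ConicFrm}^{\mathrm{op}}\to\mathsf{rocLoc},\quad (\Omega X,\uparrow,\downarrow)\mapsto(X,R_{\uparrow\downarrow}),\quad f^{-1}\mapsto f,$$ are well defined and form an adjunction $\mathsf{Cone}\dashv\mathsf{Rel}$ such that $\mathsf{Cone}\circ\mathsf{Rel}=\mathrm{id}$ and the counit is the identity. For every $(X,R)$ in $\mathsf{rocLoc}$ one has an inclusion of sublocales $R\subseteq R_{\uparrow_R\downarrow_R}$, and the unit at $(X,R)$ is this inclusion, i.e. the monotone map $(X,R)\to(X,R_{\uparrow_R\downarrow_R})$ carried by $\mathrm{id}_X$. -/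

import Mathlib

open CategoryTheory Opposite

universe u

namespace LocalicCones

/-! ### Binary coproducts of frames -/

section Coproduct

variable {L M N : Type u} [Order.Frame L] [Order.Frame M] [Order.Frame N]

/-- A lower set of `L × M` is a coproduct ideal if it is closed under all joins (including the empty
join) in each of the two variables separately. -/
def IsCoprodIdeal (I : LowerSet (L × M)) : Prop :=
  (∀ (S : Set L) (y : M), (∀ x ∈ S, (x, y) ∈ I) → (sSup S, y) ∈ I) ∧
    (∀ (x : L) (S : Set M), (∀ y ∈ S, (x, y) ∈ I) → (x, sSup S) ∈ I)

theorem mem_himp_iff {P : Type u} [PartialOrder P] (A I : LowerSet P) (p : P) :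
    p ∈ A ⇨ I ↔ ∀ q ≤ p, q ∈ A → q ∈ I := by
  rw [← LowerSet.Iic_le, le_himp_iff]
  constructor
  · intro h q hq hA
    exact h ⟨hq, hA⟩
  · rintro h q ⟨hq, hA⟩
    exact h q hq hA

variable (L M) in
/-- The coproduct ideals form a sublocale of the frame of lower sets of `L × M`. -/
def coprodIdeals : Sublocale (LowerSet (L × M)) where
  carrier := {I | IsCoprodIdeal I}
  sInf_mem' := by
    intro s hs
    constructor
    · intro S y h
      rw [LowerSet.mem_sInf_iff]
      intro I hI
      exact (hs hI).1 S y fun x hx => LowerSet.mem_sInf_iff.1 (h x hx) I hI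
    · intro x S h
      rw [LowerSet.mem_sInf_iff]
      intro I hI
      exact (hs hI).2 x S fun y hy => LowerSet.mem_sInf_iff.1 (h y hy) I hI
  himp_mem' := by
    intro A I hI
    constructor
    · intro S y h
      rw [mem_himp_iff]
      rintro ⟨a, b⟩ ⟨ha, hb⟩ hA
      have e : a = sSup ((fun x => a ⊓ x) '' S) := by
        rw [sSup_image, ← inf_sSup_eq]
        exact (inf_eq_left.2 ha).symm
      rw [e]
      refine hI.1 _ _ ?_
      rintro _ ⟨x, hx, rfl⟩
      exact (mem_himp_iff A I (x, y)).1 (h x hx) (a ⊓ x, b) ⟨inf_le_right, hb⟩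
        (A.lower (show (a ⊓ x, b) ≤ (a, b) from ⟨inf_le_left, le_rfl⟩) hA)
    · intro x S h
      rw [mem_himp_iff]
      rintro ⟨a, b⟩ ⟨ha, hb⟩ hA
      have e : b = sSup ((fun y => b ⊓ y) '' S) := by
        rw [sSup_image, ← inf_sSup_eq]
        exact (inf_eq_left.2 hb).symm
      rw [e]
      refine hI.2 _ _ ?_
      rintro _ ⟨y, hy, rfl⟩
      exact (mem_himp_iff A I (x, y)).1 (h y hy) (a, b ⊓ y) ⟨ha, inf_le_right⟩
        (A.lower (show (a, b ⊓ y) ≤ (a, b) from ⟨le_rfl, inf_le_left⟩) hA)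

variable (L M) in
/-- The coproduct `L ⊗ M` of two frames, realised as the frame of coproduct ideals. -/
abbrev Coprod : Type u := ↥(coprodIdeals L M)

/-- The basic rectangle `x ⊗ y`: the least coproduct ideal that contains `(x, y)`. -/
def rect (x : L) (y : M) : Coprod L M := (coprodIdeals L M).restrict (LowerSet.Iic (x, y))

theorem rect_le_iff {x : L} {y : M} {I : Coprod L M} : rect x y ≤ I ↔ (x, y) ∈ I.1 := by
  rw [rect, (coprodIdeals L M).giRestrict.gc.le_iff_le, LowerSet.Iic_le]

theorem rect_mono {x x' : L} {y y' : M} (hx : x ≤ x') (hy : y ≤ y') : rect x y ≤ rect x' y' :=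
  rect_le_iff.2 ((rect x' y').1.lower (show (x, y) ≤ (x', y') from ⟨hx, hy⟩)
    (rect_le_iff.1 le_rfl))

theorem rect_inf_rect (x x' : L) (y y' : M) :
    rect x y ⊓ rect x' y' = rect (x ⊓ x') (y ⊓ y') := by
  simp only [rect]
  rw [← map_inf]
  congr 1
  ext p
  simp [Prod.le_def]

theorem coprod_le_iff {I J : Coprod L M} : I ≤ J ↔ ∀ x y, rect x y ≤ I → rect x y ≤ J := by
  constructor
  · intro h x y hx
    exact hx.trans h
  · rintro h ⟨x, y⟩ hp
    exact rect_le_iff.1 (h x y (rect_le_iff.2 hp))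

variable (L M) in
/-- The first coproduct injection `x ↦ x ⊗ ⊤`. -/
def inl : FrameHom L (Coprod L M) where
  toFun x := rect x ⊤
  map_inf' x x' := by rw [rect_inf_rect, inf_idem]
  map_top' := by
    refine top_le_iff.1 (coprod_le_iff.2 fun x y _ => rect_mono le_top le_top)
  map_sSup' S := by
    refine le_antisymm ?_ (sSup_le ?_)
    · rw [rect_le_iff]
      refine (sSup ((fun x => rect x ⊤) '' S) : Coprod L M).2.1 S ⊤ fun x hx => ?_
      exact rect_le_iff.1 (le_sSup ⟨x, hx, rfl⟩)
    · rintro _ ⟨x, hx, rfl⟩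
      exact rect_mono (le_sSup hx) le_rfl

variable (L M) in
/-- The second coproduct injection `y ↦ ⊤ ⊗ y`. -/
def inr : FrameHom M (Coprod L M) where
  toFun y := rect ⊤ y
  map_inf' y y' := by rw [rect_inf_rect, inf_idem]
  map_top' := by
    refine top_le_iff.1 (coprod_le_iff.2 fun x y _ => rect_mono le_top le_top)
  map_sSup' S := by
    refine le_antisymm ?_ (sSup_le ?_)
    · rw [rect_le_iff]
      refine (sSup ((fun y => rect ⊤ y) '' S) : Coprod L M).2.2 ⊤ S fun y hy => ?_
      exact rect_le_iff.1 (le_sSup ⟨y, hy, rfl⟩)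
    · rintro _ ⟨y, hy, rfl⟩
      exact rect_mono le_rfl (le_sSup hy)

theorem inl_inf_inr (x : L) (y : M) : inl L M x ⊓ inr L M y = rect x y := by
  change rect x ⊤ ⊓ rect ⊤ y = _
  rw [rect_inf_rect, inf_top_eq, top_inf_eq]

/-- The coproduct ideal of all `(x, y)` with `h x ⊓ k y ≤ n`. -/
def copairAdj (h : FrameHom L N) (k : FrameHom M N) (n : N) : Coprod L M :=
  ⟨⟨{p | h p.1 ⊓ k p.2 ≤ n}, fun _ _ hqp hp =>
      (inf_le_inf (OrderHomClass.mono h hqp.1) (OrderHomClass.mono k hqp.2)).trans hp⟩, by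
    constructor
    · intro S y hS
      change h (sSup S) ⊓ k y ≤ n
      rw [map_sSup, sSup_inf_eq]
      simp only [iSup_le_iff]
      rintro _ ⟨x, hx, rfl⟩
      exact hS x hx
    · intro x S hS
      change h x ⊓ k (sSup S) ≤ n
      rw [map_sSup, inf_sSup_eq]
      simp only [iSup_le_iff]
      rintro _ ⟨y, hy, rfl⟩
      exact hS y hy⟩

theorem copair_gc (h : FrameHom L N) (k : FrameHom M N) :
    GaloisConnection (fun I : Coprod L M => ⨆ p ∈ I.1, h p.1 ⊓ k p.2) (copairAdj h k) := by
  intro I n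
  simp only [iSup_le_iff]
  rfl

/-- The copairing `[h, k] : L ⊗ M → N`. -/
def copair (h : FrameHom L N) (k : FrameHom M N) : FrameHom (Coprod L M) N where
  toFun I := ⨆ p ∈ I.1, h p.1 ⊓ k p.2
  map_inf' I J := by
    refine le_antisymm (le_inf ((copair_gc h k).monotone_l inf_le_left)
      ((copair_gc h k).monotone_l inf_le_right)) ?_
    simp only [iSup_inf_eq, inf_iSup_eq, iSup_le_iff]
    intro q hq p hp
    refine le_trans (le_of_eq ?_) (le_iSup₂_of_le (p ⊓ q)
      ⟨I.1.lower inf_le_left ‹_›, J.1.lower inf_le_right ‹_›⟩ le_rfl)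
    simp only [Prod.fst_inf, Prod.snd_inf, map_inf]
    ac_rfl
  map_top' := by
    refine top_le_iff.1 (le_iSup₂_of_le (⊤, ⊤) trivial ?_)
    simp
  map_sSup' S := by
    rw [sSup_image]
    exact (copair_gc h k).l_sSup

theorem copair_rect (h : FrameHom L N) (k : FrameHom M N) (x : L) (y : M) :
    copair h k (rect x y) = h x ⊓ k y := by
  refine le_antisymm (((copair_gc h k) _ _).2 (rect_le_iff.2 ?_)) ?_
  · exact (le_rfl : h x ⊓ k y ≤ h x ⊓ k y)
  · exact le_iSup₂_of_le (f := fun p (_ : p ∈ (rect x y).1) => h p.1 ⊓ k p.2) (x, y)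
      (rect_le_iff.1 le_rfl) le_rfl

/-- Frame maps out of `L ⊗ M` are determined by their values on rectangles. -/
theorem coprod_hom_ext {f g : FrameHom (Coprod L M) N}
    (h : ∀ x y, f (rect x y) = g (rect x y)) : f = g := by
  ext I
  have e : I = sSup {J | ∃ x y, rect x y ≤ I ∧ J = rect x y} := by
    refine le_antisymm (coprod_le_iff.2 fun x y hxy => le_sSup ⟨x, y, hxy, rfl⟩) (sSup_le ?_)
    rintro _ ⟨x, y, hxy, rfl⟩
    exact hxy
  rw [e, map_sSup, map_sSup]
  congr 1
  refine Set.image_congr ?_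
  rintro _ ⟨x, y, -, rfl⟩
  exact h x y

/-- The frame map `h ⊗ h : L ⊗ L → M ⊗ M`. If `h` is the inverse image map of a map of locales `f`,
this is the inverse image map of `f × f`. -/
def coprodMap (h : FrameHom L M) : FrameHom (Coprod L L) (Coprod M M) :=
  copair ((inl M M).comp h) ((inr M M).comp h)

theorem coprodMap_rect (h : FrameHom L M) (x y : L) :
    coprodMap h (rect x y) = rect (h x) (h y) := by
  rw [coprodMap, copair_rect]
  exact inl_inf_inr _ _

end Coproduct

/-! ### The sublocale presented by a binary relation -/

section Saturated

variable {F N : Type u} [Order.Frame F] [Order.Frame N]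

/-- The sublocale of all `r`-saturated elements. -/
def saturated (r : F → F → Prop) : Sublocale F where
  carrier := {s | ∀ a b c, r a b → (a ⊓ c ≤ s ↔ b ⊓ c ≤ s)}
  sInf_mem' := by
    intro S hS a b c hab
    simp only [le_sInf_iff]
    exact forall₂_congr fun s hs => hS hs a b c hab
  himp_mem' := by
    intro d s hs a b c hab
    rw [le_himp_iff, le_himp_iff, inf_assoc, inf_assoc]
    exact hs a b (c ⊓ d) hab

theorem restrict_le_iff (S : Sublocale F) {a : F} {s : S} : S.restrict a ≤ s ↔ a ≤ s.1 :=
  S.giRestrict.gc a s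

theorem restrict_coe (S : Sublocale F) (s : S) : S.restrict s.1 = s :=
  S.giRestrict.l_u_eq s

theorem le_restrict (S : Sublocale F) (a : F) : a ≤ (S.restrict a).1 :=
  (restrict_le_iff S).1 le_rfl

theorem saturated_restrict_eq {r : F → F → Prop} {a b : F} (h : r a b) :
    (saturated r).restrict a = (saturated r).restrict b := by
  have key : ∀ s : saturated r, a ≤ s.1 ↔ b ≤ s.1 := fun s => by
    simpa using s.2 a b ⊤ h
  refine le_antisymm ?_ ?_
  · rw [restrict_le_iff, key]
    exact le_restrict _ b
  · rw [restrict_le_iff, ← key]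
    exact le_restrict _ a

/-- A frame map that equalises `r` factors through the quotient map of `r`. -/
theorem exists_saturated_lift (r : F → F → Prop) (g : FrameHom F N)
    (hg : ∀ a b, r a b → g a = g b) :
    ∃ k : FrameHom (saturated r) N, k.comp (saturated r).restrict = g := by
  have gr : ∀ a, g ((saturated r).restrict a).1 = g a := by
    intro a
    refine le_antisymm ?_ (OrderHomClass.mono g (le_restrict _ a))
    have gc : ∀ x n, g x ≤ n ↔ x ≤ sSup {y | g y ≤ n} := by
      intro x n
      refine ⟨fun h => le_sSup h, fun h => (OrderHomClass.mono g h).trans ?_⟩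
      rw [map_sSup]
      refine sSup_le ?_
      rintro _ ⟨y, hy, rfl⟩
      exact hy
    let s : saturated r := ⟨sSup {y | g y ≤ g a}, by
      intro x y c hxy
      rw [← gc, ← gc, map_inf, map_inf, hg x y hxy]⟩
    have h1 : a ≤ s.1 := (gc a (g a)).1 le_rfl
    exact (gc _ _).2 ((restrict_le_iff (saturated r)).2 h1)
  refine ⟨{ toFun := fun s => g s.1, map_inf' := ?_, map_top' := ?_, map_sSup' := ?_ }, ?_⟩
  · intro a b
    exact map_inf g a.1 b.1
  · exact map_top g
  · intro S
    have e : sSup S = (saturated r).restrict (sSup (Subtype.val '' S)) := by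
      rw [map_sSup, Set.image_image]
      simp only [restrict_coe, Set.image_id']
    rw [e, gr, map_sSup, Set.image_image]
  · ext a
    exact gr a

end Saturated

/-! ### Open maps and open cone relations -/

section OpenCones

variable {L M : Type u} [Order.Frame L] [Order.Frame M]

/-- The frame map `h : M → L` is the inverse image map of an open map of locales: it has a left
adjoint which satisfies Frobenius reciprocity. -/
def IsOpenFrameMap (h : FrameHom M L) : Prop :=
  ∃ l : L → M, GaloisConnection l h ∧ ∀ (x : L) (y : M), l (x ⊓ h y) = l x ⊓ y

/-- The direct image `x ↦ ⋀ {y | x ≤ h y}` along `h`. It is the left adjoint of `h`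
whenever there is one. -/
def directImage (h : FrameHom M L) (x : L) : M := sInf {y | x ≤ h y}

theorem directImage_eq {h : FrameHom M L} {l : L → M} (gc : GaloisConnection l h) :
    directImage h = l := by
  funext x
  refine le_antisymm (sInf_le (gc.le_u_l x)) (le_sInf fun y hy => gc.l_le hy)

theorem IsOpenFrameMap.gc {h : FrameHom M L} (H : IsOpenFrameMap h) :
    GaloisConnection (directImage h) h := by
  obtain ⟨l, gc, -⟩ := H
  rwa [directImage_eq gc]

theorem IsOpenFrameMap.frobenius {h : FrameHom M L} (H : IsOpenFrameMap h) (x : L) (y : M) :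
    directImage h (x ⊓ h y) = directImage h x ⊓ y := by
  obtain ⟨l, gc, fr⟩ := H
  rw [directImage_eq gc]
  exact fr x y

/-- The inverse image map of the source map of a localic relation `R`. -/
def source (R : Sublocale (Coprod L L)) : FrameHom L R := R.restrict.comp (inl L L)

/-- The inverse image map of the target map of a localic relation `R`. -/
def target (R : Sublocale (Coprod L L)) : FrameHom L R := R.restrict.comp (inr L L)

/-- A localic relation has open cones if its source and target maps are open. -/
def HasOpenCones (R : Sublocale (Coprod L L)) : Prop :=
  IsOpenFrameMap (source R) ∧ IsOpenFrameMap (target R)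

/-- The induced up cone, the direct image along the target of the inverse image along the source. -/
def HasOpenCones.up {R : Sublocale (Coprod L L)} (H : HasOpenCones R) : sSupHom L L where
  toFun x := directImage (target R) (source R x)
  map_sSup' S := by
    rw [map_sSup, H.2.gc.l_sSup, iSup_image, sSup_image]

/-- The induced down cone, the direct image along the source of the inverse image along the
target. -/
def HasOpenCones.down {R : Sublocale (Coprod L L)} (H : HasOpenCones R) : sSupHom L L where
  toFun x := directImage (source R) (target R x)
  map_sSup' S := by
    rw [map_sSup, H.1.gc.l_sSup, iSup_image, sSup_image]

/-- A pair of cones is parallel. -/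
def Parallel (up down : L → L) : Prop :=
  ∀ x y, up x ⊓ y ≤ up (x ⊓ down y) ∧ x ⊓ down y ≤ down (up x ⊓ y)

theorem HasOpenCones.parallel {R : Sublocale (Coprod L L)} (H : HasOpenCones R) :
    Parallel H.up H.down := by
  intro x y
  constructor
  · change directImage (target R) (source R x) ⊓ y ≤ directImage (target R) (source R (x ⊓ _))
    rw [← H.2.frobenius, map_inf]
    exact H.2.gc.monotone_l (inf_le_inf_left _ (H.1.gc.le_u_l _))
  · change x ⊓ directImage (source R) (target R y) ≤ directImage (source R) (target R (_ ⊓ y))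
    rw [inf_comm, ← H.1.frobenius, map_inf, inf_comm]
    exact H.1.gc.monotone_l (inf_le_inf_right _ (H.2.gc.le_u_l _))

end OpenCones

/-! ### The relation induced by a pair of cones -/

section InducedRelation

variable {L : Type u} [Order.Frame L]

/-- The relation on rectangles: `x ⊗ y ∼ x' ⊗ y'` iff `up x ⊓ y = up x' ⊓ y'` and
`x ⊓ down y = x' ⊓ down y'`. -/
def Sim (up down : L → L) (a b : Coprod L L) : Prop :=
  ∃ x y x' y', a = rect x y ∧ b = rect x' y' ∧
    up x ⊓ y = up x' ⊓ y' ∧ x ⊓ down y = x' ⊓ down y'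

/-- The localic relation induced by a pair of cones. -/
def inducedRel (up down : L → L) : Sublocale (Coprod L L) := saturated (Sim up down)

theorem mono_of_sSupHom (c : sSupHom L L) : Monotone c := OrderHomClass.mono c

theorem inducedRel_restrict_reduced {up down : sSupHom L L} (par : Parallel up down) (x y : L) :
    (inducedRel up down).restrict (rect x y) =
      (inducedRel up down).restrict (rect (x ⊓ down y) (up x ⊓ y)) := by
  refine saturated_restrict_eq ⟨x, y, _, _, rfl, rfl, ?_, ?_⟩
  · refine le_antisymm (le_inf (par x y).1 le_rfl) ?_
    exact inf_le_right
  · refine le_antisymm (le_inf le_rfl (par x y).2) ?_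
    exact inf_le_left

/-- The two halves of the fact that `∼` is stable under meets with rectangles. -/
theorem reduced_inf_le {up down : sSupHom L L} (par : Parallel up down) {a b c d : L}
    (h1 : up a ⊓ b = up c ⊓ d) (h2 : a ⊓ down b = c ⊓ down d) (x y : L) :
    up (a ⊓ x) ⊓ (b ⊓ y) ≤ up (c ⊓ x) ⊓ (d ⊓ y) ∧
      a ⊓ x ⊓ down (b ⊓ y) ≤ c ⊓ x ⊓ down (d ⊓ y) := by
  have mu := mono_of_sSupHom up
  have md := mono_of_sSupHom down
  have hD : a ⊓ x ⊓ down (b ⊓ y) ≤ c ⊓ x := by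
    refine le_inf ?_ (inf_le_left.trans inf_le_right)
    calc a ⊓ x ⊓ down (b ⊓ y) ≤ a ⊓ down b := inf_le_inf inf_le_left (md inf_le_left)
      _ ≤ c := h2.le.trans inf_le_left
  have hU : up (a ⊓ x) ⊓ (b ⊓ y) ≤ d ⊓ y := by
    refine le_inf ?_ (inf_le_right.trans inf_le_right)
    calc up (a ⊓ x) ⊓ (b ⊓ y) ≤ up a ⊓ b := inf_le_inf (mu inf_le_left) inf_le_left
      _ ≤ d := h1.le.trans inf_le_right
  exact ⟨le_inf ((par _ _).1.trans (mu hD)) hU, le_inf hD ((par _ _).2.trans (md hU))⟩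

/-- The element of `inducedRel up down` of all `(x, y)` with `x ⊓ down y ≤ z`. -/
def downOpen {up down : sSupHom L L} (par : Parallel up down) (z : L) : inducedRel up down :=
  ⟨⟨⟨{p | p.1 ⊓ down p.2 ≤ z}, fun _ _ hqp hp =>
      (inf_le_inf hqp.1 (mono_of_sSupHom down hqp.2)).trans hp⟩, by
    constructor
    · intro S y hS
      change sSup S ⊓ down y ≤ z
      rw [sSup_inf_eq]
      exact iSup₂_le hS
    · intro x S hS
      change x ⊓ down (sSup S) ≤ z
      rw [map_sSup, inf_sSup_eq]
      simp only [iSup_le_iff]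
      rintro _ ⟨y, hy, rfl⟩
      exact hS y hy⟩, by
    have key : ∀ (a b c d : L) (e : Coprod L L), up a ⊓ b = up c ⊓ d →
        a ⊓ down b = c ⊓ down d → ∀ I : Coprod L L,
        (∀ x y, rect x y ≤ I ↔ x ⊓ down y ≤ z) →
        rect c d ⊓ e ≤ I → rect a b ⊓ e ≤ I := by
      intro a b c d e h1 h2 I hI h
      refine coprod_le_iff.2 fun x y hxy => ?_
      have hs : rect (c ⊓ x) (d ⊓ y) ≤ I := by
        rw [← rect_inf_rect]
        exact (inf_le_inf_left _ (hxy.trans inf_le_right)).trans h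
      have ht : rect (a ⊓ x) (b ⊓ y) ≤ I := by
        rw [hI] at hs ⊢
        exact (reduced_inf_le par h1 h2 x y).2.trans hs
      rw [← rect_inf_rect] at ht
      exact (le_inf (hxy.trans inf_le_left) le_rfl).trans ht
    rintro _ _ e ⟨x, y, x', y', rfl, rfl, h1, h2⟩
    exact ⟨key x' y' x y e h1.symm h2.symm _ (fun _ _ => rect_le_iff),
      key x y x' y' e h1 h2 _ (fun _ _ => rect_le_iff)⟩⟩

/-- The element of `inducedRel up down` of all `(x, y)` with `up x ⊓ y ≤ z`. -/
def upOpen {up down : sSupHom L L} (par : Parallel up down) (z : L) : inducedRel up down :=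
  ⟨⟨⟨{p | up p.1 ⊓ p.2 ≤ z}, fun _ _ hqp hp =>
      (inf_le_inf (mono_of_sSupHom up hqp.1) hqp.2).trans hp⟩, by
    constructor
    · intro S y hS
      change up (sSup S) ⊓ y ≤ z
      rw [map_sSup, sSup_inf_eq]
      simp only [iSup_le_iff]
      rintro _ ⟨x, hx, rfl⟩
      exact hS x hx
    · intro x S hS
      change up x ⊓ sSup S ≤ z
      rw [inf_sSup_eq]
      exact iSup₂_le hS⟩, by
    have key : ∀ (a b c d : L) (e : Coprod L L), up a ⊓ b = up c ⊓ d →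
        a ⊓ down b = c ⊓ down d → ∀ I : Coprod L L,
        (∀ x y, rect x y ≤ I ↔ up x ⊓ y ≤ z) →
        rect c d ⊓ e ≤ I → rect a b ⊓ e ≤ I := by
      intro a b c d e h1 h2 I hI h
      refine coprod_le_iff.2 fun x y hxy => ?_
      have hs : rect (c ⊓ x) (d ⊓ y) ≤ I := by
        rw [← rect_inf_rect]
        exact (inf_le_inf_left _ (hxy.trans inf_le_right)).trans h
      have ht : rect (a ⊓ x) (b ⊓ y) ≤ I := by
        rw [hI] at hs ⊢
        exact (reduced_inf_le par h1 h2 x y).1.trans hs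
      rw [← rect_inf_rect] at ht
      exact (le_inf (hxy.trans inf_le_left) le_rfl).trans ht
    rintro _ _ e ⟨x, y, x', y', rfl, rfl, h1, h2⟩
    exact ⟨key x' y' x y e h1.symm h2.symm _ (fun _ _ => rect_le_iff),
      key x y x' y' e h1 h2 _ (fun _ _ => rect_le_iff)⟩⟩

theorem source_inducedRel {up down : sSupHom L L} (par : Parallel up down) (z : L) :
    source (inducedRel up down) z = downOpen par z := by
  refine le_antisymm ?_ ?_
  · refine (restrict_le_iff _).2 ?_
    exact rect_le_iff.2 (show z ⊓ down ⊤ ≤ z from inf_le_left)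
  · refine coprod_le_iff.2 fun x y hxy => ?_
    have hz : x ⊓ down y ≤ z := rect_le_iff.1 hxy
    refine (restrict_le_iff _).1 ?_
    rw [inducedRel_restrict_reduced par]
    exact OrderHomClass.mono _ (rect_mono hz le_top)

theorem target_inducedRel {up down : sSupHom L L} (par : Parallel up down) (z : L) :
    target (inducedRel up down) z = upOpen par z := by
  refine le_antisymm ?_ ?_
  · refine (restrict_le_iff _).2 ?_
    exact rect_le_iff.2 (show up ⊤ ⊓ z ≤ z from inf_le_right)
  · refine coprod_le_iff.2 fun x y hxy => ?_
    have hz : up x ⊓ y ≤ z := rect_le_iff.1 hxy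
    refine (restrict_le_iff _).1 ?_
    rw [inducedRel_restrict_reduced par]
    exact OrderHomClass.mono _ (rect_mono le_top hz)

/-- The relation induced by a join-preserving parallel pair of cones has open cones. -/
theorem hasOpenCones_inducedRel {up down : sSupHom L L} (par : Parallel up down) :
    HasOpenCones (inducedRel up down) := by
  constructor
  · have gc : GaloisConnection (fun O : inducedRel up down => ⨆ p ∈ O.1.1, p.1 ⊓ down p.2)
        (source (inducedRel up down)) := by
      intro O z
      rw [source_inducedRel par]
      simp only [iSup_le_iff]
      rfl
    refine ⟨_, gc, fun O z => le_antisymm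
      (le_inf (gc.monotone_l inf_le_left) (gc.l_le inf_le_right)) ?_⟩
    simp only [iSup_inf_eq, iSup_le_iff]
    intro p hp
    refine le_trans (le_of_eq ?_) (le_iSup₂_of_le
      (f := fun q (_ : q ∈ (O ⊓ source (inducedRel up down) z).1.1) => q.1 ⊓ down q.2)
      (p.1 ⊓ z, p.2) ⟨O.1.1.lower
        (show (p.1 ⊓ z, p.2) ≤ p from ⟨inf_le_left, le_rfl⟩) hp, ?_⟩ le_rfl)
    · exact inf_right_comm _ _ _
    · rw [source_inducedRel par]
      exact (inf_le_left.trans inf_le_right : p.1 ⊓ z ⊓ down p.2 ≤ z)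
  · have gc : GaloisConnection (fun O : inducedRel up down => ⨆ p ∈ O.1.1, up p.1 ⊓ p.2)
        (target (inducedRel up down)) := by
      intro O z
      rw [target_inducedRel par]
      simp only [iSup_le_iff]
      rfl
    refine ⟨_, gc, fun O z => le_antisymm
      (le_inf (gc.monotone_l inf_le_left) (gc.l_le inf_le_right)) ?_⟩
    simp only [iSup_inf_eq, iSup_le_iff]
    intro p hp
    refine le_trans (le_of_eq ?_) (le_iSup₂_of_le
      (f := fun q (_ : q ∈ (O ⊓ target (inducedRel up down) z).1.1) => up q.1 ⊓ q.2)
      (p.1, p.2 ⊓ z) ⟨O.1.1.lower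
        (show (p.1, p.2 ⊓ z) ≤ p from ⟨le_rfl, inf_le_left⟩) hp, ?_⟩ le_rfl)
    · exact inf_assoc _ _ _
    · rw [target_inducedRel par]
      exact (inf_le_right.trans inf_le_right : up p.1 ⊓ (p.2 ⊓ z) ≤ z)

end InducedRelation

/-! ### The category of locales with localic relations -/

/-- The inverse image map of a map of locales. -/
def invImage {X Y : Locale.{u}} (f : X ⟶ Y) : FrameHom Y X := (Quiver.Hom.unop f).hom

/-- The map of locales with a given inverse image map. -/
def ofInvImage {X Y : Locale.{u}} (h : FrameHom Y X) : X ⟶ Y := Quiver.Hom.op (Frm.ofHom h)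

/-- A locale equipped with a localic relation, that is, a sublocale of `X × X`. -/
structure RLoc : Type (u + 1) where
  /-- The underlying locale. -/
  X : Locale.{u}
  /-- The localic relation. -/
  rel : Sublocale (Coprod X X)

/-- The map of locales `f` is monotone: `f × f` restricts to a map `R ⟶ Q`, where `R` and `Q` are the
relations of `A` and `B`. -/
def IsMonotone {A B : RLoc.{u}} (f : A.X ⟶ B.X) : Prop :=
  ∃ g : FrameHom B.rel A.rel,
    g.comp B.rel.restrict = A.rel.restrict.comp (coprodMap (invImage f))

namespace RLoc

/-- Monotone maps. -/
@[ext]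
structure Hom (A B : RLoc.{u}) : Type u where
  /-- The underlying map of locales. -/
  base : A.X ⟶ B.X
  monotone : IsMonotone base

instance : Category RLoc.{u} where
  Hom := Hom
  id A := ⟨𝟙 A.X, FrameHom.id _, by
    have e : coprodMap (invImage (𝟙 A.X)) = FrameHom.id _ :=
      coprod_hom_ext fun x y => coprodMap_rect _ x y
    rw [e]
    rfl⟩
  comp {A B C} f g := ⟨f.base ≫ g.base, by
    obtain ⟨k, hk⟩ := f.monotone
    obtain ⟨l, hl⟩ := g.monotone
    refine ⟨k.comp l, ?_⟩
    have e : coprodMap (invImage (f.base ≫ g.base)) =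
        (coprodMap (invImage f.base)).comp (coprodMap (invImage g.base)) :=
      coprod_hom_ext fun x y => by
        rw [coprodMap_rect, FrameHom.comp_apply, coprodMap_rect, coprodMap_rect]
        rfl
    rw [e, FrameHom.comp_assoc, hl, ← FrameHom.comp_assoc, hk, FrameHom.comp_assoc]⟩
  id_comp f := Hom.ext (Category.id_comp f.base)
  comp_id f := Hom.ext (Category.comp_id f.base)
  assoc f g h := Hom.ext (Category.assoc f.base g.base h.base)

end RLoc

/-- The full subcategory of `RLoc` on the locales equipped with an open cone relation. -/
abbrev RocLoc : Type (u + 1) :=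
  ObjectProperty.FullSubcategory fun A : RLoc.{u} => HasOpenCones A.rel

/-! ### The category of conic frames -/

/-- A conic frame: a frame with a join-preserving parallel pair of cones. -/
structure ConicFrm : Type (u + 1) where
  /-- The underlying frame. -/
  L : Frm.{u}
  /-- The up cone. -/
  up : sSupHom L L
  /-- The down cone. -/
  down : sSupHom L L
  parallel : Parallel up down

namespace ConicFrm

/-- Conic morphisms. -/
@[ext]
structure Hom (C D : ConicFrm.{u}) : Type u where
  /-- The underlying frame map. -/
  base : C.L ⟶ D.L
  up_le : ∀ x, D.up (base.hom x) ≤ base.hom (C.up x)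
  down_le : ∀ x, D.down (base.hom x) ≤ base.hom (C.down x)

instance : Category ConicFrm.{u} where
  Hom := Hom
  id C := ⟨𝟙 C.L, fun _ => le_rfl, fun _ => le_rfl⟩
  comp f g := ⟨f.base ≫ g.base,
    fun x => (g.up_le _).trans (OrderHomClass.mono g.base.hom (f.up_le x)),
    fun x => (g.down_le _).trans (OrderHomClass.mono g.base.hom (f.down_le x))⟩
  id_comp f := Hom.ext (Category.id_comp f.base)
  comp_id f := Hom.ext (Category.comp_id f.base)
  assoc f g h := Hom.ext (Category.assoc f.base g.base h.base)

end ConicFrm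

/-! ### The two functors -/

theorem source_monotone {A B : RLoc.{u}} {f : A.X ⟶ B.X} {g : FrameHom B.rel A.rel}
    (hg : g.comp B.rel.restrict = A.rel.restrict.comp (coprodMap (invImage f))) (x : B.X) :
    source A.rel (invImage f x) = g (source B.rel x) := by
  have h := DFunLike.congr_fun hg (rect x ⊤)
  simp only [FrameHom.comp_apply, coprodMap_rect, map_top] at h
  exact h.symm

theorem target_monotone {A B : RLoc.{u}} {f : A.X ⟶ B.X} {g : FrameHom B.rel A.rel}
    (hg : g.comp B.rel.restrict = A.rel.restrict.comp (coprodMap (invImage f))) (x : B.X) :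
    target A.rel (invImage f x) = g (target B.rel x) := by
  have h := DFunLike.congr_fun hg (rect ⊤ x)
  simp only [FrameHom.comp_apply, coprodMap_rect, map_top] at h
  exact h.symm

/-- The functor `(X, R) ↦ (Ω X, up, down)`, `f ↦ f⁻¹`. -/
def Cone : RocLoc.{u} ⥤ ConicFrm.{u}ᵒᵖ where
  obj A := op ⟨Frm.of A.obj.X, A.property.up, A.property.down, A.property.parallel⟩
  map {A B} f := Quiver.Hom.op
    { base := Frm.ofHom (invImage f.hom.base)
      up_le := by
        intro x
        obtain ⟨g, hg⟩ := f.hom.monotone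
        refine A.property.2.gc.l_le ?_
        change source A.obj.rel (invImage f.hom.base x) ≤
          target A.obj.rel (invImage f.hom.base (B.property.up x))
        rw [source_monotone hg, target_monotone hg]
        exact OrderHomClass.mono g (B.property.2.gc.le_u_l _)
      down_le := by
        intro x
        obtain ⟨g, hg⟩ := f.hom.monotone
        refine A.property.1.gc.l_le ?_
        change target A.obj.rel (invImage f.hom.base x) ≤
          source A.obj.rel (invImage f.hom.base (B.property.down x))
        rw [source_monotone hg, target_monotone hg]
        exact OrderHomClass.mono g (B.property.1.gc.le_u_l _) }
  map_id _ := rfl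
  map_comp _ _ := rfl

/-- A conic frame, regarded as a locale with a localic relation. -/
def ConicFrm.toRLoc (C : ConicFrm.{u}) : RLoc.{u} where
  X := Locale.of C.L
  rel := inducedRel C.up C.down

theorem ConicFrm.Hom.equalises_sim {C D : ConicFrm.{u}} (f : ConicFrm.Hom C D)
    {s t : Coprod C.L C.L} (hst : Sim C.up C.down s t) :
    (inducedRel D.up D.down).restrict (coprodMap f.base.hom s) =
      (inducedRel D.up D.down).restrict (coprodMap f.base.hom t) := by
  have key : ∀ a b c d : C.L, C.up a ⊓ b = C.up c ⊓ d → a ⊓ C.down b = c ⊓ C.down d →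
      (inducedRel D.up D.down).restrict (rect (f.base.hom a) (f.base.hom b)) ≤
        (inducedRel D.up D.down).restrict (rect (f.base.hom c) (f.base.hom d)) := by
    intro a b c d h1 h2
    rw [inducedRel_restrict_reduced D.parallel]
    refine OrderHomClass.mono _ (rect_mono ?_ ?_)
    · refine (inf_le_inf_left _ (f.down_le b)).trans ?_
      rw [← map_inf, h2, map_inf]
      exact inf_le_left
    · refine (inf_le_inf_right _ (f.up_le a)).trans ?_
      rw [← map_inf, h1, map_inf]
      exact inf_le_right
  obtain ⟨a, b, c, d, rfl, rfl, h1, h2⟩ := hst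
  rw [coprodMap_rect, coprodMap_rect]
  exact le_antisymm (key a b c d h1 h2) (key c d a b h1.symm h2.symm)

theorem ConicFrm.Hom.isMonotone {C D : ConicFrm.{u}} (f : ConicFrm.Hom C D) :
    IsMonotone (A := D.toRLoc) (B := C.toRLoc) (ofInvImage f.base.hom) :=
  exists_saturated_lift _ _ fun _ _ h => f.equalises_sim h

/-- The functor `(Ω X, up, down) ↦ (X, inducedRel up down)`, `f⁻¹ ↦ f`. -/
def Rel : ConicFrm.{u}ᵒᵖ ⥤ RocLoc.{u} where
  obj C := ⟨C.unop.toRLoc, hasOpenCones_inducedRel C.unop.parallel⟩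
  map f := ⟨⟨ofInvImage f.unop.base.hom, f.unop.isMonotone⟩⟩
  map_id _ := rfl
  map_comp _ _ := rfl

end LocalicCones

/-!
In an open cone relation `R`, the units of `t_! ⊣ t⁻¹` and `s_! ⊣ s⁻¹` read `s⁻¹ x ≤ t⁻¹ (↑x)` and
`t⁻¹ y ≤ s⁻¹ (↓y)`, so `x ⊗ y` and `(x ⊓ ↓y) ⊗ (↑x ⊓ y)` restrict to the same open of `R`. That open
therefore depends only on the `∼`-class of `x ⊗ y`, which means that every element of `R` is
`∼`-saturated, that is, `R ⊆ R_{↑↓}`. Conversely, the parallel law of a conic frame gives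
`s⁻¹ x ≤ t⁻¹ z ↔ ↑x ≤ z` in `R_{↑↓}`, and dually for `↓`, so the cones of `R_{↑↓}` are `↑` and `↓`.
The unit and the counit are carried by identities, which makes the triangle identities trivial.
-/

namespace LocalicCones

section Sublocales

variable {F : Type u} [Order.Frame F]

theorem le_saturated_iff {S : Sublocale F} {r : F → F → Prop} :
    S ≤ saturated r ↔ ∀ a b, r a b → S.restrict a = S.restrict b := by
  constructor
  · intro h a b hab
    refine eq_of_forall_ge_iff fun s => ?_
    simpa only [restrict_le_iff, inf_top_eq] using h s.2 a b ⊤ hab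
  · intro h w hw a b c hab
    have le_iff (d : F) : d ≤ w ↔ S.restrict d ≤ ⟨w, hw⟩ :=
      (restrict_le_iff S (s := ⟨w, hw⟩)).symm
    rw [le_iff, le_iff, map_inf, map_inf, h a b hab]

theorem saturated_ker_restrict (S : Sublocale F) :
    saturated (fun a b => S.restrict a = S.restrict b) = S := by
  refine le_antisymm (fun w hw => ?_) (le_saturated_iff.2 fun _ _ => id)
  have restrict_le : (S.restrict w).1 ≤ w := by
    simpa only [inf_top_eq, le_refl, iff_true] using hw _ w ⊤ (restrict_coe S (S.restrict w))
  rw [← restrict_le.antisymm (le_restrict S w)]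
  exact (S.restrict w).2

theorem exists_comp_restrict_eq_of_le {S T : Sublocale F} (h : S ≤ T) :
    ∃ k : FrameHom T S, k.comp T.restrict = S.restrict := by
  rw [← saturated_ker_restrict T] at h ⊢
  exact exists_saturated_lift _ _ (le_saturated_iff.1 h)

end Sublocales

section OpenConeRelations

variable {L : Type u} [Order.Frame L] {R : Sublocale (Coprod L L)}

theorem restrict_rect (x y : L) :
    R.restrict (rect x y) = source R x ⊓ target R y := by
  rw [← inl_inf_inr, map_inf]
  rfl

theorem HasOpenCones.up_le_iff (H : HasOpenCones R) {x z : L} :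
    H.up x ≤ z ↔ source R x ≤ target R z :=
  H.2.gc _ _

theorem HasOpenCones.down_le_iff (H : HasOpenCones R) {y z : L} :
    H.down y ≤ z ↔ target R y ≤ source R z :=
  H.1.gc _ _

theorem HasOpenCones.restrict_reduced (H : HasOpenCones R) (x y : L) :
    R.restrict (rect x y) = R.restrict (rect (x ⊓ H.down y) (H.up x ⊓ y)) := by
  have source_le : source R x ≤ target R (H.up x) := H.up_le_iff.1 le_rfl
  have target_le : target R y ≤ source R (H.down y) := H.down_le_iff.1 le_rfl
  refine le_antisymm ?_ (OrderHomClass.mono _ (rect_mono inf_le_left inf_le_right))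
  simp only [restrict_rect, map_inf]
  exact le_inf (inf_le_inf_left _ target_le) (inf_le_inf_right _ source_le)

theorem HasOpenCones.le_inducedRel (H : HasOpenCones R) : R ≤ inducedRel H.up H.down := by
  refine le_saturated_iff.2 ?_
  rintro _ _ ⟨x, y, x', y', rfl, rfl, up_eq, down_eq⟩
  rw [H.restrict_reduced x y, H.restrict_reduced x' y', up_eq, down_eq]

end OpenConeRelations

section ConesOfInducedRelation

variable {L : Type u} [Order.Frame L] {up down : sSupHom L L}

theorem rect_le_source_inducedRel_iff (par : Parallel up down) {a b x : L} :
    rect a b ≤ (source (inducedRel up down) x).1 ↔ a ⊓ down b ≤ x := by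
  rw [source_inducedRel par, rect_le_iff]
  rfl

theorem rect_le_target_inducedRel_iff (par : Parallel up down) {a b y : L} :
    rect a b ≤ (target (inducedRel up down) y).1 ↔ up a ⊓ b ≤ y := by
  rw [target_inducedRel par, rect_le_iff]
  rfl

theorem source_le_target_inducedRel_iff (par : Parallel up down) {x z : L} :
    source (inducedRel up down) x ≤ target (inducedRel up down) z ↔ up x ≤ z := by
  rw [← Subtype.coe_le_coe, coprod_le_iff]
  simp only [rect_le_source_inducedRel_iff par, rect_le_target_inducedRel_iff par]
  refine ⟨fun h => ?_, fun h a b hab => ?_⟩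
  · simpa only [inf_top_eq] using h x ⊤ inf_le_left
  · calc
      up a ⊓ b ≤ up (a ⊓ down b) := (par a b).1
      _ ≤ up x := mono_of_sSupHom up hab
      _ ≤ z := h

theorem target_le_source_inducedRel_iff (par : Parallel up down) {y z : L} :
    target (inducedRel up down) y ≤ source (inducedRel up down) z ↔ down y ≤ z := by
  rw [← Subtype.coe_le_coe, coprod_le_iff]
  simp only [rect_le_source_inducedRel_iff par, rect_le_target_inducedRel_iff par]
  refine ⟨fun h => ?_, fun h a b hab => ?_⟩
  · simpa only [top_inf_eq] using h ⊤ y inf_le_right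
  · calc
      a ⊓ down b ≤ down (up a ⊓ b) := (par a b).2
      _ ≤ down y := mono_of_sSupHom down hab
      _ ≤ z := h

theorem up_inducedRel (par : Parallel up down) (H : HasOpenCones (inducedRel up down)) :
    H.up = up := by
  ext x
  refine eq_of_forall_ge_iff fun z => ?_
  rw [H.up_le_iff, source_le_target_inducedRel_iff par]

theorem down_inducedRel (par : Parallel up down) (H : HasOpenCones (inducedRel up down)) :
    H.down = down := by
  ext y
  refine eq_of_forall_ge_iff fun z => ?_
  rw [H.down_le_iff, target_le_source_inducedRel_iff par]

end ConesOfInducedRelation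

theorem ConicFrm.eqToHom_unop_base {C D : ConicFrm.{u}ᵒᵖ} (h : C = D) :
    (eqToHom h).unop.base = eqToHom (congrArg (fun E => E.unop.L) h.symm) := by
  subst h
  rfl

theorem cone_obj_rel_obj (C : ConicFrm.{u}ᵒᵖ) : Cone.obj (Rel.obj C) = C := by
  obtain ⟨L, up, down, par⟩ := C
  refine congrArg op ?_
  congr 1
  · exact up_inducedRel par _
  · exact down_inducedRel par _

theorem rel_comp_cone : Rel.{u} ⋙ Cone.{u} = 𝟭 ConicFrm.{u}ᵒᵖ := by
  refine CategoryTheory.Functor.ext cone_obj_rel_obj fun C D f => ?_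
  refine Quiver.Hom.unop_inj (ConicFrm.Hom.ext ?_)
  change f.unop.base = ((eqToHom (cone_obj_rel_obj D).symm).unop.base ≫ f.unop.base) ≫
    (eqToHom (cone_obj_rel_obj C)).unop.base
  rw [ConicFrm.eqToHom_unop_base, ConicFrm.eqToHom_unop_base]
  rfl

theorem eqToHom_rel_comp_cone_app_base (C : ConicFrm.{u}ᵒᵖ) :
    ((eqToHom rel_comp_cone).app C).unop.base = 𝟙 C.unop.L := by
  rw [eqToHom_app, ConicFrm.eqToHom_unop_base]
  rfl

theorem coprodMap_id (L : Type u) [Order.Frame L] :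
    coprodMap (FrameHom.id L) = FrameHom.id (Coprod L L) :=
  coprod_hom_ext fun x y => coprodMap_rect _ x y

theorem isMonotone_id_of_le {X : Locale.{u}} {R Q : Sublocale (Coprod X X)} (h : R ≤ Q) :
    IsMonotone (A := ⟨X, R⟩) (B := ⟨X, Q⟩) (𝟙 X) := by
  obtain ⟨k, hk⟩ := exists_comp_restrict_eq_of_le h
  refine ⟨k, hk.trans ?_⟩
  change R.restrict = R.restrict.comp (coprodMap (FrameHom.id X))
  rw [coprodMap_id, FrameHom.comp_id]

/-- The inclusion of an open cone relation into the relation induced by its cones, as a monotone map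
carried by the identity. It is the unit of the adjunction `Cone ⊣ Rel`. -/
def inclusionInduced (A : RocLoc.{u}) : A ⟶ Rel.obj (Cone.obj A) :=
  ⟨⟨𝟙 A.obj.X, isMonotone_id_of_le A.property.le_inducedRel⟩⟩

/-- The adjunction between the functor of cones and the functor of induced relations. Its counit is
an `eqToHom` because the equality `Rel ⋙ Cone = 𝟭` does not hold definitionally. -/
def coneRelAdjunction : Cone.{u} ⊣ Rel.{u} where
  unit :=
    { app := inclusionInduced
      naturality := fun _ _ _ => rfl }
  counit := eqToHom rel_comp_cone
  left_triangle_components A := by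
    refine Quiver.Hom.unop_inj (ConicFrm.Hom.ext ?_)
    change ((eqToHom rel_comp_cone).app (Cone.obj A)).unop.base ≫ 𝟙 _ = 𝟙 _
    rw [eqToHom_rel_comp_cone_app_base]
    rfl
  right_triangle_components C := by
    refine InducedCategory.hom_ext (RLoc.Hom.ext ?_)
    exact congrArg Quiver.Hom.op (eqToHom_rel_comp_cone_app_base C)

end LocalicCones

/-- `Cone` is left adjoint to `Rel`. The counit is the identity (the composite `Rel ⋙ Cone` is equal
to the identity functor, and all components of the counit are carried by identity frame maps). The
unit at `(X, R)` is the inclusion of `R` into the relation induced by the cones of `R`, carried by the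
identity map of `X`. -/
theorem mainTheorem1 :
    ∃ (adj : LocalicCones.Cone.{u} ⊣ LocalicCones.Rel.{u})
      (h : LocalicCones.Rel.{u} ⋙ LocalicCones.Cone.{u} = 𝟭 LocalicCones.ConicFrm.{u}ᵒᵖ),
      adj.counit = eqToHom h ∧
        (∀ C : LocalicCones.ConicFrm.{u}ᵒᵖ, (adj.counit.app C).unop.base = 𝟙 C.unop.L) ∧
        ∀ A : LocalicCones.RocLoc.{u},
          A.obj.rel ≤ LocalicCones.inducedRel A.property.up A.property.down ∧
            (adj.unit.app A).hom.base = 𝟙 A.obj.X :=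
  ⟨LocalicCones.coneRelAdjunction, LocalicCones.rel_comp_cone, rfl,
    LocalicCones.eqToHom_rel_comp_cone_app_base,
    fun A => ⟨A.property.le_inducedRel, rfl⟩⟩
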